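/- Let $\mathbb{F}$ be an arbitrary field and $\ell\ge 1$ an integer. Definitions. A matrix polynomial $P\in\mathbb{F}[\lambda]^{p\times q}$ has grade $d$ if $P(\lambda)=\sum_{i=0}^{d}P_i\lambda^i$ with constant matrices $P_i$ ($P_d=0$ is allowed), and then $\mathrm{rev}_d P(\lambda):=\lambda^dP(\lambda^{-1})$; $\deg P$ is the largest $k$ with $P_k\ne 0$ (with the convention $\deg P=0$ if $P$ is zero or has no entries), and the $i$-th row degree of $P$ is the degree of its $i$-th row. A square matrix polynomial is unimodular if its determinant is a nonzero constant. A matrix polynomial is a minimal basis if its rows are linearly independent over $\mathbb{F}(\lambda)$ and the sum of its row degrees is least among all bases, consisting of polynomial vectors, of the subspace over $\mathbb{F}(\lambda)$ spanned by its rows (a matrix without rows is a minimal basis of the zero subspace). Two minimal bases $K\in\mathbb{F}[\lambda]^{p\times q}$ and $N\in\mathbb{F}[\lambda]^{r\times q}$ are dual if $p+r=q$ and $KN^T=0$. A matrix polynomial $L$ of degree $\ell>0$ is an $\ell$-ification of $P$ if for some $s\ge 0$ there are unimodular $U,V$ with $$U(\lambda)L(\lambda)V(\lambda)=\begin{bmatrix}I_s&0\\0&P(\lambda)\end{bmatrix}.$$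 It is a strong $\ell$-ification of $P$, where $P$ is considered with grade $d$, if in addition $P$ has grade $d$ and $\mathrm{rev}_\ell L$ is an $\ell$-ification of $\mathrm{rev}_d P$. A block minimal bases degree-$\ell$ matrix polynomial is a matrix polynomial $$\mathcal{L}(\lambda)=\begin{bmatrix}M(\lambda)&K_2(\lambda)^T\\K_1(\lambda)&0\end{bmatrix},$$ where $M$ is an arbitrary matrix polynomial of grade $\ell$ and $K_1,K_2$ are minimal bases of degree $\ell$; one of $K_1,K_2$ (but not both) may be missing, i.e. have no rows, and then the degree condition is imposed on the other only. It is strong if, in addition, all the row degrees of $K_1$ and of $K_2$ are equal to $\ell$, the row degrees of a minimal basis dual to $K_1$ are all equal, and the row degrees of a minimal basis dual to $K_2$ are all equal. Theorem. Let $\mathcal{L}$ be a block minimal bases degree-$\ell$ matrix polynomial as above, let $N_1$ be a minimal basis dual to $K_1$ and $N_2$ a minimal basis dual to $K_2$, and put $$Q(\lambda):=N_2(\lambda)M(\lambda)N_1(\lambda)^T.$$ (a) $\mathcal{L}$ is an $\ell$-ification of $Q$. (b) If $\mathcal{L}$ is a strong block minimal bases degree-$\ell$ matrix polynomial, then $\mathcal{L}$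 is a strong $\ell$-ification of $Q$, where $Q$ is considered as a matrix polynomial of grade $\ell+\deg N_1+\deg N_2$. -/

import Mathlib

open Polynomial

namespace MatPoly

variable {F : Type*} [Field F]

section Basic

variable {m n : Type*} [Fintype m] [Fintype n]

/-- The matrix polynomial `P` can be written as `∑ i ≤ d, Pᵢ λ^i` with constant matrices `Pᵢ`
(the coefficient `P_d` may vanish). -/
def HasGrade (d : ℕ) (P : Matrix m n F[X]) : Prop :=
  ∀ i j, (P i j).natDegree ≤ d

/-- The degree of a matrix polynomial, i.e. the largest `k` with a nonzero coefficient `P_k`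
(and `0` for the zero matrix and for matrices without entries). -/
def degree (P : Matrix m n F[X]) : ℕ :=
  Finset.univ.sup fun i => Finset.univ.sup fun j => (P i j).natDegree

/-- The degree of the `i`-th row. -/
def rowDegree (P : Matrix m n F[X]) (i : m) : ℕ :=
  Finset.univ.sup fun j => (P i j).natDegree

/-- The sum of the row degrees: the order of the vector polynomials which are the rows. -/
def order (P : Matrix m n F[X]) : ℕ :=
  ∑ i, rowDegree P i

/-- The `d`-reversal `λ^d P(λ⁻¹)` of a matrix polynomial of grade `d`. -/
noncomputable def rev (d : ℕ) (P : Matrix m n F[X]) : Matrix m n F[X] :=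
  P.map (Polynomial.reflect d)

/-- The `i`-th row as a vector over the field of rational functions. -/
noncomputable def ratRow (P : Matrix m n F[X]) (i : m) : n → RatFunc F :=
  fun j => algebraMap F[X] (RatFunc F) (P i j)

/-- The rational subspace spanned by the rows. -/
noncomputable def rowSpace (P : Matrix m n F[X]) : Submodule (RatFunc F) (n → RatFunc F) :=
  Submodule.span (RatFunc F) (Set.range (ratRow P))

/-- The rows of `P` form a minimal basis of the rational subspace which they span: they are
linearly independent over the rational functions, and their order is the least among all the
polynomial bases of that subspace (all of which have the same number of elements, so that they
can be indexed by the same finite type). -/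
def IsMinimalBasis (P : Matrix m n F[X]) : Prop :=
  LinearIndependent (RatFunc F) (ratRow P) ∧
    ∀ B : Matrix m n F[X], LinearIndependent (RatFunc F) (ratRow B) →
      rowSpace B = rowSpace P → order P ≤ order B

end Basic

/-- Dual minimal bases. -/
structure IsDualMinimalBases {k r n : Type*} [Fintype k] [Fintype r] [Fintype n]
    (K : Matrix k n F[X]) (N : Matrix r n F[X]) : Prop where
  card_eq : Fintype.card k + Fintype.card r = Fintype.card n
  mul_transpose : K * N.transpose = 0
  left : IsMinimalBasis K
  right : IsMinimalBasis N

/-- Regular square matrix polynomials with constant determinant. -/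
def IsUnimodular {n : Type*} [Fintype n] [DecidableEq n] (U : Matrix n n F[X]) : Prop :=
  U.det ≠ 0 ∧ ∃ c : F, U.det = C c

/-- `L`, of degree `ℓ > 0`, is an `ℓ`-ification of `P`: for some `s` there are unimodular `U`, `V`
such that `U L V` is the block diagonal matrix with blocks `I_s` and `P`. The bijections `e`, `f`
identify the rows and columns of `L` with those of the block diagonal matrix. -/
def IsEllification {a b m n : Type*} [Fintype a] [Fintype b] [Fintype m] [Fintype n]
    [DecidableEq a] [DecidableEq b]
    (ℓ : ℕ) (L : Matrix a b F[X]) (P : Matrix m n F[X]) : Prop :=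
  0 < ℓ ∧ degree L = ℓ ∧
    ∃ (s : ℕ) (e : Fin s ⊕ m ≃ a) (f : Fin s ⊕ n ≃ b) (U : Matrix a a F[X]) (V : Matrix b b F[X]),
      IsUnimodular U ∧ IsUnimodular V ∧
        U * L * V = Matrix.reindex e f (Matrix.fromBlocks 1 0 0 P)

/-- `L` is a strong `ℓ`-ification of `P`, where `P` is considered with grade `d`. -/
def IsStrongEllification {a b m n : Type*} [Fintype a] [Fintype b] [Fintype m] [Fintype n]
    [DecidableEq a] [DecidableEq b]
    (ℓ : ℕ) (L : Matrix a b F[X]) (d : ℕ) (P : Matrix m n F[X]) : Prop :=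
  HasGrade d P ∧ IsEllification ℓ L P ∧ IsEllification ℓ (rev ℓ L) (rev d P)

section Block

variable {k₁ k₂ c₁ c₂ : Type*} [Fintype k₁] [Fintype k₂] [Fintype c₁] [Fintype c₂]

/-- The block matrix `[M, K₂ᵀ; K₁, 0]`. -/
noncomputable def blockMatrix (M : Matrix c₂ c₁ F[X]) (K₁ : Matrix k₁ c₁ F[X])
    (K₂ : Matrix k₂ c₂ F[X]) : Matrix (c₂ ⊕ k₁) (c₁ ⊕ k₂) F[X] :=
  Matrix.fromBlocks M K₂.transpose K₁ 0

/-- `[M, K₂ᵀ; K₁, 0]` is a block minimal bases degree-`ℓ` matrix polynomial. One of the blocks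
`K₁`, `K₂` may be missing, i.e. have no rows; a block which is present has degree `ℓ`. -/
structure IsBlockMinimalBases (ℓ : ℕ) (M : Matrix c₂ c₁ F[X]) (K₁ : Matrix k₁ c₁ F[X])
    (K₂ : Matrix k₂ c₂ F[X]) : Prop where
  grade : HasGrade ℓ M
  minimal₁ : IsMinimalBasis K₁
  minimal₂ : IsMinimalBasis K₂
  nonempty : Nonempty k₁ ∨ Nonempty k₂
  degree₁ : Nonempty k₁ → degree K₁ = ℓ
  degree₂ : Nonempty k₂ → degree K₂ = ℓ

/-- The row degrees of a minimal basis dual to `K` are all equal. (The row degrees of a dual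
minimal basis are determined by `K` up to order.) -/
def HasConstantDualRowDegrees {k n : Type*} [Fintype k] [Fintype n] (K : Matrix k n F[X]) : Prop :=
  ∃ (r : ℕ) (N : Matrix (Fin r) n F[X]), IsDualMinimalBases K N ∧
    ∃ ε : ℕ, ∀ i, rowDegree N i = ε

/-- `[M, K₂ᵀ; K₁, 0]` is a strong block minimal bases degree-`ℓ` matrix polynomial. -/
structure IsStrongBlockMinimalBases (ℓ : ℕ) (M : Matrix c₂ c₁ F[X]) (K₁ : Matrix k₁ c₁ F[X])
    (K₂ : Matrix k₂ c₂ F[X]) : Prop extends IsBlockMinimalBases ℓ M K₁ K₂ where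
  rowDegree₁ : ∀ i, rowDegree K₁ i = ℓ
  rowDegree₂ : ∀ i, rowDegree K₂ i = ℓ
  dual₁ : HasConstantDualRowDegrees K₁
  dual₂ : HasConstantDualRowDegrees K₂

end Block

end MatPoly

/-!
The theorem rests on one property of minimal bases: a minimal basis `K` has a polynomial right
inverse (`IsMinimalBasis.exists_rightInverse`). To see this, suppose that `q v = ∑ aᵢ Kᵢ` with
`q ≠ 0` but that `v` is not itself a polynomial combination of the rows `Kᵢ`. After subtracting such
a combination one may assume that `deg aᵢ < deg q`; then `v` has smaller degree than some row `Kᵢ`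
with `aᵢ ≠ 0`, and exchanging that row for `v` contradicts minimality. So the polynomial
combinations of the rows form a saturated submodule of `F[λ]ⁿ`, which is a direct summand because
`F[λ]` is a principal ideal domain.

If `K` and `N` are dual, with right inverses `R` and `S`, then `[K; Sᵀ]` is unimodular with
inverse `[R, Nᵀ]`, after a correction of `R` (`exists_unimodular_completion`). Multiplying
`[M, K₂ᵀ; K₁, 0]` by the unimodular matrices belonging to the two dual pairs replaces `K₁` and `K₂ᵀ` by
identity blocks, and these clear everything except the block `N₂ M N₁ᵀ`
(`exists_unimodular_reduction`). This is part (a); the degree `ℓ` of the block matrix is attained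
in whichever of `K₁`, `K₂` is present.

Part (b) is the same reduction applied to the reversals, which requires only that the reversals of
`K₁`, `K₂`, `N₁`, `N₂` have right inverses. The reversal of a minimal basis with equal row degrees
is a minimal basis (`IsMinimalBasis.rev`), since a better competitor could be reversed row by row.
The row degrees of `N₁` and `N₂` are equal because they agree with those of any other minimal
basis dual to `K₁` or `K₂` (`IsDualMinimalBases.rowDegree_eq`), again by the exchange argument.
Finally, a matrix with a right inverse does not vanish at `0`, so the reversed block matrix has
degree `ℓ` too.
-/

namespace MatPoly

/-! ### Minimal bases in terms of polynomial combinations -/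

section MinimalBasis

variable {F : Type*} [Field F] {k n : Type*}

/-- The vector with entries in `F(λ)` obtained from a polynomial vector, as an `F[λ]`-linear map. -/
noncomputable def toRatVec (F : Type*) [Field F] (n : Type*) :
    (n → F[X]) →ₗ[F[X]] (n → RatFunc F) :=
  (Algebra.linearMap F[X] (RatFunc F)).compLeft n

theorem toRatVec_injective : Function.Injective (toRatVec F n) := fun v w h => by
  funext j
  exact FaithfulSMul.algebraMap_injective F[X] (RatFunc F) (congrFun h j)

theorem toRatVec_smul (q : F[X]) (v : n → F[X]) :
    toRatVec F n (q • v) = algebraMap F[X] (RatFunc F) q • toRatVec F n v := by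
  rw [map_smul, algebraMap_smul]

theorem toRatVec_vecMul [Fintype k] (a : k → F[X]) (P : Matrix k n F[X]) :
    toRatVec F n (Matrix.vecMul a P)
      = ∑ i, algebraMap F[X] (RatFunc F) (a i) • toRatVec F n (P i) := by
  rw [Matrix.vecMul_eq_sum, map_sum]
  simp only [toRatVec_smul]

theorem linearIndependent_ratRow_iff (P : Matrix k n F[X]) :
    LinearIndependent (RatFunc F) (ratRow P) ↔ LinearIndependent F[X] P := by
  rw [← LinearIndependent.iff_fractionRing F[X] (RatFunc F)]
  exact (toRatVec F n).linearIndependent_iff (LinearMap.ker_eq_bot.2 toRatVec_injective)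

/-- Clearing denominators in the coefficients of a rational combination of the rows. -/
theorem mem_rowSpace_iff [Fintype k] (P : Matrix k n F[X]) (v : n → F[X]) :
    toRatVec F n v ∈ rowSpace P ↔ ∃ q : F[X], q ≠ 0 ∧ ∃ a, q • v = Matrix.vecMul a P := by
  constructor
  · intro h
    obtain ⟨c, hc⟩ := (Submodule.mem_span_range_iff_exists_fun _).1 h
    obtain ⟨b, hb⟩ := IsLocalization.exist_integer_multiples_of_finite (nonZeroDivisors F[X]) c
    choose a ha using hb
    refine ⟨b, nonZeroDivisors.ne_zero b.2, a, toRatVec_injective ?_⟩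
    rw [toRatVec_vecMul, map_smul, ← hc, Finset.smul_sum]
    refine Finset.sum_congr rfl fun i _ => ?_
    rw [ha, smul_assoc]
    rfl
  · rintro ⟨q, hq, a, h⟩
    have hq' : algebraMap F[X] (RatFunc F) q ≠ 0 := by simpa using hq
    rw [← Submodule.smul_mem_iff _ hq', ← toRatVec_smul, h, toRatVec_vecMul]
    exact Submodule.sum_mem _ fun i _ => Submodule.smul_mem _ _ (Submodule.subset_span ⟨i, rfl⟩)

theorem rowSpace_eq_of_forall_mem [Fintype k] {B P : Matrix k n F[X]}
    (hB : LinearIndependent F[X] B) (hP : LinearIndependent F[X] P)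
    (h : ∀ i, toRatVec F n (B i) ∈ rowSpace P) :
    rowSpace B = rowSpace P := by
  have hB' := (linearIndependent_ratRow_iff B).2 hB
  have hP' := (linearIndependent_ratRow_iff P).2 hP
  have : FiniteDimensional (RatFunc F) (rowSpace P) :=
    FiniteDimensional.span_of_finite _ (Set.finite_range _)
  refine Submodule.eq_of_le_of_finrank_eq (Submodule.span_le.2 ?_) ?_
  · rintro _ ⟨i, rfl⟩
    exact h i
  · rw [rowSpace, rowSpace, finrank_span_eq_card hB', finrank_span_eq_card hP']

/-- Minimality expressed over `F[λ]`: a competing basis consists of independent polynomial vectors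
having nonzero polynomial multiples among the polynomial combinations of the given rows. -/
theorem isMinimalBasis_iff [Fintype k] [Fintype n] (P : Matrix k n F[X]) :
    IsMinimalBasis P ↔ LinearIndependent F[X] P ∧
      ∀ B : Matrix k n F[X], LinearIndependent F[X] B →
        (∀ i, ∃ q : F[X], q ≠ 0 ∧ ∃ a, q • B i = Matrix.vecMul a P) → order P ≤ order B := by
  unfold IsMinimalBasis
  simp only [linearIndependent_ratRow_iff, ← mem_rowSpace_iff]
  refine and_congr_right fun hP => forall_congr' fun B => forall_congr' fun hB => ?_
  refine imp_congr_left ⟨fun h i => ?_, rowSpace_eq_of_forall_mem hB hP⟩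
  rw [← h]
  exact Submodule.subset_span ⟨i, rfl⟩

/-- The exchange argument: a row of a minimal basis cannot be replaced by a vector of smaller
degree. -/
theorem IsMinimalBasis.exists_rowDegree_le [Fintype k] [Fintype n]
    {P : Matrix k n F[X]} (hP : IsMinimalBasis P) {q : F[X]} (hq : q ≠ 0)
    {v : n → F[X]} {a : k → F[X]} (h : q • v = Matrix.vecMul a P)
    {i : k} (hi : a i ≠ 0) : ∃ j, v j ≠ 0 ∧ rowDegree P i ≤ (v j).natDegree := by
  classical
  rw [isMinimalBasis_iff] at hP
  obtain ⟨hind, hmin⟩ := hP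
  rw [Matrix.vecMul_eq_sum] at h
  have hB : LinearIndependent F[X] (P.updateRow i v) := by
    refine hind.update i v ⟨q, mem_nonZeroDivisors_of_ne_zero hq,
      Finsupp.equivFunOnFinite.symm a, mem_nonZeroDivisors_of_ne_zero hi, ?_⟩
    have hlc := Finsupp.linearCombination_apply F[X] (v := (P : k → n → F[X]))
      (Finsupp.equivFunOnFinite.symm a)
    exact h.trans (hlc.trans (Finsupp.sum_fintype _ _ fun _ => zero_smul _ _)).symm
  have hv : v ≠ 0 := by
    have := hB.ne_zero i
    rwa [Matrix.updateRow_self] at this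
  have hle : order P ≤ order (P.updateRow i v) := by
    refine hmin _ hB fun j => ?_
    by_cases hj : j = i
    · subst hj
      exact ⟨q, hq, a, by rw [Matrix.updateRow_self, h, Matrix.vecMul_eq_sum]⟩
    · refine ⟨1, one_ne_zero, Pi.single j 1, ?_⟩
      rw [Matrix.updateRow_ne hj, one_smul, Matrix.single_one_vecMul]
      rfl
  have hrow : rowDegree P i ≤ Finset.univ.sup fun j => (v j).natDegree := by
    unfold order at hle
    rw [← Finset.add_sum_erase _ _ (Finset.mem_univ i),
      ← Finset.add_sum_erase _ _ (Finset.mem_univ i)] at hle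
    have hrest : ∑ j ∈ Finset.univ.erase i, rowDegree (P.updateRow i v) j
        = ∑ j ∈ Finset.univ.erase i, rowDegree P j :=
      Finset.sum_congr rfl fun j hj => by
        rw [rowDegree, rowDegree, Matrix.updateRow_ne (Finset.ne_of_mem_erase hj)]
    have hself : rowDegree (P.updateRow i v) i
        = Finset.univ.sup fun j => (v j).natDegree := by
      rw [rowDegree, Matrix.updateRow_self]
    omega
  by_contra! hcon
  rcases Nat.eq_zero_or_pos (rowDegree P i) with h0 | h0
  · obtain ⟨j, hj⟩ := Function.ne_iff.1 hv
    have := hcon j hj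
    omega
  · refine hrow.not_gt ((Finset.sup_lt_iff h0).2 fun j _ => ?_)
    by_cases hj : v j = 0
    · rwa [hj, natDegree_zero]
    · exact hcon j hj

theorem natDegree_le_rowDegree [Fintype n] (P : Matrix k n F[X]) (i : k) (j : n) :
    (P i j).natDegree ≤ rowDegree P i :=
  Finset.le_sup (f := fun j => (P i j).natDegree) (Finset.mem_univ j)

/-- The polynomial combinations of the rows of a minimal basis form a saturated submodule: a vector
that is not such a combination, but has a multiple which is, would after reduction of the
coefficients modulo the multiplier have smaller degree than one of the rows it may replace. -/
theorem IsMinimalBasis.saturated [Fintype k] [Fintype n]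
    {P : Matrix k n F[X]} (hP : IsMinimalBasis P) {q : F[X]} (hq : q ≠ 0)
    {v : n → F[X]} {a : k → F[X]} (h : q • v = Matrix.vecMul a P) :
    ∃ b, v = Matrix.vecMul b P := by
  classical
  set r : k → F[X] := fun i => a i % q with hr
  set w : n → F[X] := v - Matrix.vecMul (fun i => a i / q) P with hw
  have hrw : q • w = Matrix.vecMul r P := by
    have ha : a = r + q • fun i => a i / q := by
      funext i
      simp only [hr, Pi.add_apply, Pi.smul_apply, smul_eq_mul]
      exact (EuclideanDomain.mod_add_div (a i) q).symm
    rw [hw, smul_sub, h, ← Matrix.smul_vecMul, sub_eq_iff_eq_add, ← Matrix.add_vecMul, ← ha]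
  by_cases hr0 : ∀ i, r i = 0
  · refine ⟨fun i => a i / q, ?_⟩
    have : q • w = 0 := by rw [hrw, show r = 0 from funext hr0, Matrix.zero_vecMul]
    exact sub_eq_zero.1 ((smul_eq_zero.1 this).resolve_left hq)
  · exfalso
    push Not at hr0
    obtain ⟨i₁, hi₁⟩ := hr0
    obtain ⟨i, hi, hmax⟩ := Finset.exists_max_image
      (Finset.univ.filter fun i => r i ≠ 0) (rowDegree P) ⟨i₁, by simpa using hi₁⟩
    simp only [Finset.mem_filter, Finset.mem_univ, true_and] at hi hmax
    obtain ⟨j, hj0, hj⟩ := hP.exists_rowDegree_le hq hrw hi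
    have hlt : ∀ i, r i ≠ 0 → (r i).natDegree < q.natDegree := fun i hi =>
      natDegree_lt_natDegree hi (EuclideanDomain.mod_lt (a i) hq)
    have hsum : q * w j = ∑ i, r i * P i j := congrFun hrw j
    have hdeg : (q * w j).natDegree ≤ (q.natDegree - 1) + rowDegree P i := by
      rw [hsum]
      refine natDegree_sum_le_of_forall_le _ _ fun i' _ => ?_
      by_cases hi' : r i' = 0
      · simp [hi']
      · refine natDegree_mul_le.trans (add_le_add ?_ ?_)
        · have := hlt i' hi'
          omega
        · exact (natDegree_le_rowDegree P i' j).trans (hmax i' hi')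
    rw [natDegree_mul hq hj0] at hdeg
    have := hlt i hi
    omega

/-- A minimal basis has a polynomial right inverse: by saturation the quotient of `F[λ]ⁿ` by the
combinations of the rows is torsion free, hence free, so that these combinations form a direct
summand. -/
theorem IsMinimalBasis.exists_rightInverse [Fintype k] [Fintype n] [DecidableEq k]
    {P : Matrix k n F[X]} (hP : IsMinimalBasis P) : ∃ R : Matrix n k F[X], P * R = 1 := by
  classical
  have hinj : Function.Injective P.vecMulLinear :=
    Matrix.vecMul_injective_iff.2 ((isMinimalBasis_iff P).1 hP).1
  let S := LinearMap.range P.vecMulLinear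
  have htf : Module.IsTorsionFree F[X] ((n → F[X]) ⧸ S) := by
    rw [Module.isTorsionFree_iff_smul_eq_zero]
    intro q x hx
    induction x using Submodule.Quotient.induction_on with | _ v
    rw [← Submodule.Quotient.mk_smul, Submodule.Quotient.mk_eq_zero] at hx
    rw [or_iff_not_imp_left, Submodule.Quotient.mk_eq_zero]
    intro hq
    obtain ⟨a, ha⟩ := hx
    obtain ⟨b, hb⟩ := hP.saturated hq ha.symm
    exact ⟨b, hb.symm⟩
  obtain ⟨s, hs⟩ := Module.projective_lifting_property S.mkQ LinearMap.id S.mkQ_surjective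
  -- The projection onto the combinations of the rows, followed by taking coefficients.
  let g : (n → F[X]) →ₗ[F[X]] (k → F[X]) :=
    (LinearEquiv.ofInjective _ hinj).symm.toLinearMap ∘ₗ
      LinearMap.codRestrict S (LinearMap.id - s ∘ₗ S.mkQ) (fun v => by
        rw [← Submodule.Quotient.mk_eq_zero]
        have := LinearMap.congr_fun hs (S.mkQ v)
        simpa [sub_eq_zero] using this.symm)
  have hg : ∀ a, g (Matrix.vecMul a P) = a := fun a => by
    simp only [g, LinearMap.comp_apply, LinearEquiv.coe_coe]
    rw [LinearEquiv.symm_apply_eq]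
    ext1
    have : S.mkQ (Matrix.vecMul a P) = 0 := (Submodule.Quotient.mk_eq_zero _).2 ⟨a, rfl⟩
    simp [this]
  refine ⟨Matrix.of fun j => g (Pi.single j 1), ?_⟩
  refine Matrix.ext fun i i' => ?_
  have h := congrFun (hg (Pi.single i 1)) i'
  rw [Matrix.single_one_vecMul, LinearMap.pi_apply_eq_sum_univ g] at h
  rw [Matrix.mul_apply, Matrix.one_apply]
  rw [Finset.sum_apply, Pi.single_apply] at h
  simp only [eq_comm (a := i'), Pi.smul_apply, smul_eq_mul] at h
  refine Eq.trans ?_ h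
  refine Finset.sum_congr rfl fun j _ => ?_
  have hj : (fun j' => if j = j' then 1 else 0 : n → F[X]) = Pi.single j 1 := by
    funext j'
    simp [Pi.single_apply, eq_comm]
  rw [hj]
  rfl

end MinimalBasis


/-! ### Reversals -/

section Reversal

variable {F : Type*} [Field F] {k m n : Type*}

theorem natDegree_reflect_le_of_le {d : ℕ} {p : F[X]} (h : p.natDegree ≤ d) :
    (reflect d p).natDegree ≤ d := by
  rw [natDegree_le_iff_coeff_eq_zero]
  intro i hi
  rw [coeff_reflect, revAt_eq_self_of_lt hi]
  exact coeff_eq_zero_of_natDegree_lt (by omega)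

theorem reflect_sum {ι : Type*} (s : Finset ι) (d : ℕ) (f : ι → F[X]) :
    reflect d (∑ i ∈ s, f i) = ∑ i ∈ s, reflect d (f i) :=
  map_sum (⟨⟨reflect d, reflect_zero⟩, fun p q => reflect_add p q d⟩ : F[X] →+ F[X]) f s

theorem HasGrade.rev [Fintype m] [Fintype n] {d : ℕ} {P : Matrix m n F[X]} (h : HasGrade d P) :
    HasGrade d (rev d P) :=
  fun i j => natDegree_reflect_le_of_le (h i j)

theorem HasGrade.mul [Fintype k] [Fintype m] [Fintype n] {d e : ℕ} {P : Matrix k m F[X]}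
    {Q : Matrix m n F[X]} (hP : HasGrade d P) (hQ : HasGrade e Q) : HasGrade (d + e) (P * Q) :=
  fun i j => natDegree_sum_le_of_forall_le _ _ fun l _ =>
    natDegree_mul_le.trans (add_le_add (hP i l) (hQ l j))

theorem HasGrade.transpose [Fintype m] [Fintype n] {d : ℕ} {P : Matrix m n F[X]}
    (h : HasGrade d P) : HasGrade d P.transpose :=
  fun i j => h j i

theorem rev_mul [Fintype k] [Fintype m] [Fintype n] {d e : ℕ} {P : Matrix k m F[X]}
    {Q : Matrix m n F[X]} (hP : HasGrade d P) (hQ : HasGrade e Q) :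
    rev (d + e) (P * Q) = rev d P * rev e Q := by
  refine Matrix.ext fun i j => ?_
  simp only [MatPoly.rev, Matrix.map_apply, Matrix.mul_apply, reflect_sum]
  exact Finset.sum_congr rfl fun l _ => reflect_mul _ _ (hP i l) (hQ l j)

theorem hasGrade_degree [Fintype m] [Fintype n] (P : Matrix m n F[X]) :
    HasGrade (degree P) P := fun i j =>
  (natDegree_le_rowDegree P i j).trans (Finset.le_sup (f := rowDegree P) (Finset.mem_univ i))

theorem degree_le_iff [Fintype m] [Fintype n] {d : ℕ} {P : Matrix m n F[X]} :
    degree P ≤ d ↔ HasGrade d P := by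
  simp [degree, HasGrade, Finset.sup_le_iff]

theorem rowDegree_le_iff [Fintype n] {d : ℕ} {P : Matrix m n F[X]} {i : m} :
    rowDegree P i ≤ d ↔ ∀ j, (P i j).natDegree ≤ d := by
  simp [rowDegree, Finset.sup_le_iff]

/-- Reversing a polynomial combination of rows, each row `i` with respect to a bound `d i` of its
degree, gives the combination of the reversed rows with the coefficients reversed with respect to
the complementary bounds. -/
theorem reflect_vecMul [Fintype k] {D N : ℕ} {d : k → ℕ} {a : k → F[X]} {P : Matrix k n F[X]}
    (hd : ∀ i, d i ≤ D) (ha : ∀ i, (a i).natDegree ≤ N) (hP : ∀ i j, (P i j).natDegree ≤ d i)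
    (j : n) : reflect (N + D) (Matrix.vecMul a P j) =
      Matrix.vecMul (fun i => reflect (N + D - d i) (a i))
        (Matrix.of fun i j => reflect (d i) (P i j)) j := by
  simp only [Matrix.vecMul, dotProduct, Matrix.of_apply, reflect_sum]
  refine Finset.sum_congr rfl fun i _ => ?_
  rw [← reflect_mul _ _ ((ha i).trans _) (hP i j), Nat.sub_add_cancel]
  · exact (hd i).trans (Nat.le_add_left _ _)
  · have := hd i
    omega

theorem exists_natDegree_le [Finite k] (a : k → F[X]) : ∃ N, ∀ i, (a i).natDegree ≤ N := by
  have := Fintype.ofFinite k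
  exact ⟨Finset.univ.sup fun i => (a i).natDegree, fun i =>
    Finset.le_sup (f := fun i => (a i).natDegree) (Finset.mem_univ i)⟩

theorem linearIndependent_reflect_rows [Fintype k] {d : k → ℕ} {P : Matrix k n F[X]}
    (hP : ∀ i j, (P i j).natDegree ≤ d i) (h : LinearIndependent F[X] P) :
    LinearIndependent F[X] (Matrix.of fun i j => reflect (d i) (P i j)) := by
  replace h := Matrix.vecMul_injective_iff.2 h
  refine Matrix.vecMul_injective_iff.1 ?_
  rw [← Matrix.coe_vecMulLinear, injective_iff_map_eq_zero] at h ⊢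
  intro a ha
  obtain ⟨N, hN⟩ := exists_natDegree_le a
  obtain ⟨D, hD⟩ : ∃ D, ∀ i, d i ≤ D :=
    ⟨Finset.univ.sup d, fun i => Finset.le_sup (Finset.mem_univ i)⟩
  have key : Matrix.vecMul (fun i => reflect (N + D - d i) (a i)) P = 0 := by
    funext j
    have := reflect_vecMul (P := Matrix.of fun i j => reflect (d i) (P i j)) hD hN
      (fun i j => natDegree_reflect_le_of_le (hP i j)) j
    simp only [Matrix.of_apply, reflect_reflect] at this
    refine this.symm.trans ?_
    rw [show Matrix.vecMul a _ = 0 from ha]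
    exact reflect_zero
  funext i
  exact reflect_eq_zero_iff.1 (congrFun (h _ key) i)

/-- The reversal of a minimal basis all of whose rows have degree `d` is a minimal basis: reversing
a basis row by row does not increase the row degrees, so a better competitor of the reversal would
give a better competitor of the basis itself. -/
theorem IsMinimalBasis.rev [Fintype k] [Fintype n] {d : ℕ} {P : Matrix k n F[X]}
    (hP : IsMinimalBasis P) (hd : ∀ i, rowDegree P i = d) : IsMinimalBasis (rev d P) := by
  have hgr : ∀ i j, (P i j).natDegree ≤ d := fun i j =>
    (natDegree_le_rowDegree P i j).trans (hd i).le
  rw [isMinimalBasis_iff] at hP ⊢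
  obtain ⟨hind, hmin⟩ := hP
  refine ⟨linearIndependent_reflect_rows (d := fun _ => d) hgr hind, fun B hB hspan => ?_⟩
  set B' : Matrix k n F[X] := Matrix.of fun i j => reflect (rowDegree B i) (B i j) with hB'
  have h1 : order (MatPoly.rev d P) ≤ order P := Finset.sum_le_sum fun i _ => by
    rw [hd i, rowDegree_le_iff]
    exact fun j => natDegree_reflect_le_of_le (hgr i j)
  have h2 : order B' ≤ order B := Finset.sum_le_sum fun i _ => by
    rw [rowDegree_le_iff]
    exact fun j => natDegree_reflect_le_of_le (natDegree_le_rowDegree B i j)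
  refine h1.trans ((hmin B' ?_ fun i => ?_).trans h2)
  · exact linearIndependent_reflect_rows (natDegree_le_rowDegree B) hB
  · obtain ⟨q, hq, a, h⟩ := hspan i
    obtain ⟨N, hN⟩ := exists_natDegree_le a
    set D := d + rowDegree B i
    set N' := N + q.natDegree
    refine ⟨reflect (N' + D - rowDegree B i) q, by simpa using hq,
      fun l => reflect (N' + D - d) (a l), ?_⟩
    funext j
    have hr := reflect_vecMul (P := MatPoly.rev d P) (D := D) (N := N') (d := fun _ => d)
      (fun _ => Nat.le_add_right _ _) (fun l => (hN l).trans (Nat.le_add_right _ _))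
      (fun l j => natDegree_reflect_le_of_le (hgr l j)) j
    have hPP : (Matrix.of fun l j => reflect d (MatPoly.rev d P l j)) = P :=
      Matrix.ext fun l j => reflect_reflect
    rw [hPP, ← h] at hr
    rw [← hr, Pi.smul_apply, Pi.smul_apply, smul_eq_mul, smul_eq_mul, hB', Matrix.of_apply,
      ← reflect_mul _ _ (by omega) (natDegree_le_rowDegree B i j), Nat.sub_add_cancel (by omega)]

end Reversal


/-! ### Dual minimal bases -/

section Dual

variable {F : Type*} [Field F] {k r c : Type*} [Fintype k] [Fintype r] [Fintype c]

/-- Two complementary families of rows that are annihilated by each other and have right inverses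
are blocks of a unimodular matrix and of its inverse: the product of `[K; Sᵀ]` and `[R, Nᵀ]` is the
identity in either order, once `R` is corrected by a combination of the columns of `Nᵀ`. -/
theorem exists_unimodular_completion [DecidableEq k] [DecidableEq r] [DecidableEq c]
    {K : Matrix k c F[X]} {N : Matrix r c F[X]}
    (hcard : Fintype.card k + Fintype.card r = Fintype.card c) (hKN : K * N.transpose = 0)
    (hK : ∃ R : Matrix c k F[X], K * R = 1) (hN : ∃ S : Matrix c r F[X], N * S = 1) :
    ∃ (R : Matrix c k F[X]) (S : Matrix c r F[X]), K * R = 1 ∧ N * S = 1 ∧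
      S.transpose * R = 0 ∧ R * K + N.transpose * S.transpose = 1 := by
  obtain ⟨R, hR⟩ := hK
  obtain ⟨S, hS⟩ := hN
  have hS' : S.transpose * N.transpose = 1 := by
    rw [← Matrix.transpose_mul, hS, Matrix.transpose_one]
  set R' := R - N.transpose * (S.transpose * R) with hR'
  have h1 : K * R' = 1 := by
    rw [hR', Matrix.mul_sub, ← Matrix.mul_assoc, hKN, Matrix.zero_mul, hR, sub_zero]
  have h2 : S.transpose * R' = 0 := by
    rw [hR', Matrix.mul_sub, ← Matrix.mul_assoc S.transpose N.transpose, hS', Matrix.one_mul,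
      sub_self]
  refine ⟨R', S, h1, hS, h2, ?_⟩
  have h3 : Matrix.fromRows K S.transpose * Matrix.fromCols R' N.transpose = 1 := by
    rw [Matrix.fromRows_mul_fromCols, h1, hKN, h2, hS', Matrix.fromBlocks_one]
  rw [Matrix.mul_eq_one_comm_of_card_eq _ _ _ (by simpa using hcard)] at h3
  rwa [Matrix.fromCols_mul_fromRows] at h3

/-- Every matrix whose rows are annihilated by `K` consists of polynomial combinations of the rows
of a minimal basis dual to `K`. -/
theorem IsDualMinimalBases.exists_eq_mul {K : Matrix k c F[X]} {N : Matrix r c F[X]}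
    (h : IsDualMinimalBases K N) {m : Type*} (A : Matrix m c F[X]) (hA : K * A.transpose = 0) :
    ∃ T : Matrix m r F[X], A = T * N := by
  classical
  obtain ⟨R, S, -, -, -, h1⟩ := exists_unimodular_completion h.card_eq h.mul_transpose
    h.left.exists_rightInverse h.right.exists_rightInverse
  refine ⟨A * S, ?_⟩
  have h2 : A.transpose = N.transpose * (S.transpose * A.transpose) := by
    calc A.transpose = (R * K + N.transpose * S.transpose) * A.transpose := by
          rw [h1, Matrix.one_mul]
      _ = _ := by
          rw [Matrix.add_mul, Matrix.mul_assoc, hA, Matrix.mul_zero, zero_add, Matrix.mul_assoc]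
  apply_fun Matrix.transpose at h2
  simpa [Matrix.transpose_mul] using h2

/-- If the row degrees of one minimal basis dual to `K` all equal `ε`, then so do those of any
other: no nonzero combination of the rows of the former has degree less than `ε`, and the latter
has the least possible order. -/
theorem IsDualMinimalBases.rowDegree_eq {r' : Type*} [Fintype r'] {K : Matrix k c F[X]}
    {N : Matrix r c F[X]} {N' : Matrix r' c F[X]} (h : IsDualMinimalBases K N)
    (h' : IsDualMinimalBases K N') {ε : ℕ} (hε : ∀ i, rowDegree N i = ε) (i : r') :
    rowDegree N' i = ε := by
  classical
  obtain ⟨hind, -⟩ := (isMinimalBasis_iff N).1 h.right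
  obtain ⟨hind', hmin'⟩ := (isMinimalBasis_iff N').1 h'.right
  obtain ⟨T, hT⟩ := h.exists_eq_mul N' h'.mul_transpose
  obtain ⟨T', hT'⟩ := h'.exists_eq_mul N h.mul_transpose
  have hge : ∀ i, ε ≤ rowDegree N' i := fun i => by
    have hrow : N' i = Matrix.vecMul (T i) N := by
      conv_lhs => rw [hT]
      exact Matrix.mul_apply_eq_vecMul T N i
    obtain ⟨l, hl⟩ : ∃ l, T i l ≠ 0 := by
      by_contra! hcon
      refine hind'.ne_zero i ?_
      rw [hrow, show T i = 0 from funext hcon, Matrix.zero_vecMul]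
    obtain ⟨j, -, hj⟩ := h.right.exists_rowDegree_le one_ne_zero ((one_smul _ _).trans hrow) hl
    rw [hε] at hj
    exact hj.trans (natDegree_le_rowDegree N' i j)
  have hcard : Fintype.card r' = Fintype.card r := by
    have h1 := h.card_eq
    have h2 := h'.card_eq
    omega
  let σ : r' ≃ r := Fintype.equivOfCardEq hcard
  have hle : ∑ i, rowDegree N' i ≤ ∑ _i : r', ε := by
    have := hmin' (N.submatrix σ id) (hind.comp σ σ.injective) fun i =>
      ⟨1, one_ne_zero, T' (σ i), (one_smul _ _).trans (by
        rw [← Matrix.mul_apply_eq_vecMul, ← hT']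
        rfl)⟩
    refine this.trans (le_of_eq (Finset.sum_congr rfl fun i _ => ?_))
    exact hε (σ i)
  exact ((Finset.sum_eq_sum_iff_of_le fun i _ => hge i).1
    (le_antisymm (Finset.sum_le_sum fun i _ => hge i) hle) i (Finset.mem_univ i)).symm

theorem IsDualMinimalBases.rowDegree_eq_degree {K : Matrix k c F[X]} {N : Matrix r c F[X]}
    (h : IsDualMinimalBases K N) (hK : HasConstantDualRowDegrees K) (i : r) :
    rowDegree N i = degree N := by
  obtain ⟨_, N₀, h₀, ε, hε⟩ := hK
  have hN := h₀.rowDegree_eq h hε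
  have : Nonempty r := ⟨i⟩
  change _ = Finset.univ.sup (rowDegree N)
  rw [show rowDegree N = fun _ => ε from funext hN, Finset.sup_const Finset.univ_nonempty]

end Dual

/-! ### The unimodular reduction of a block matrix -/

section Reduction

variable {F : Type*} [Field F] {k₁ k₂ c₁ c₂ m n : Type*}
  [Fintype k₁] [Fintype k₂] [Fintype c₁] [Fintype c₂] [Fintype m] [Fintype n]

theorem isUnimodular_of_mul_eq_one [DecidableEq n] {U W : Matrix n n F[X]} (h : U * W = 1) :
    IsUnimodular U := by
  have hu : IsUnit U.det := IsUnit.of_mul_eq_one W.det (by rw [← Matrix.det_mul, h, Matrix.det_one])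
  obtain ⟨c, -, hc⟩ := isUnit_iff.1 hu
  exact ⟨hu.ne_zero, c, hc.symm⟩

/-- Multiplication of `[M, K₂ᵀ; K₁, 0]` by the unimodular matrices in which `K₂ᵀ` and `K₁` are
blocks of the inverses turns `K₂ᵀ` and `K₁` into identity blocks; these serve to clear the blocks
`A = R₂ᵀ M R₁`, `B = R₂ᵀ M N₁ᵀ` and `C = N₂ M R₁` next to `N₂ M N₁ᵀ`. -/
theorem exists_unimodular_reduction [DecidableEq k₁] [DecidableEq k₂] [DecidableEq c₁]
    [DecidableEq c₂] (M : Matrix c₂ c₁ F[X])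
    {K₁ : Matrix k₁ c₁ F[X]} {N₁ : Matrix n c₁ F[X]}
    {K₂ : Matrix k₂ c₂ F[X]} {N₂ : Matrix m c₂ F[X]}
    (hcard₁ : Fintype.card k₁ + Fintype.card n = Fintype.card c₁)
    (hcard₂ : Fintype.card k₂ + Fintype.card m = Fintype.card c₂)
    (hKN₁ : K₁ * N₁.transpose = 0) (hKN₂ : K₂ * N₂.transpose = 0)
    (hK₁ : ∃ R : Matrix c₁ k₁ F[X], K₁ * R = 1) (hK₂ : ∃ R : Matrix c₂ k₂ F[X], K₂ * R = 1)
    (hN₁ : ∀ _ : DecidableEq n, ∃ S : Matrix c₁ n F[X], N₁ * S = 1)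
    (hN₂ : ∀ _ : DecidableEq m, ∃ S : Matrix c₂ m F[X], N₂ * S = 1) :
    ∃ (s : ℕ) (e : Fin s ⊕ m ≃ c₂ ⊕ k₁) (f : Fin s ⊕ n ≃ c₁ ⊕ k₂)
      (U : Matrix (c₂ ⊕ k₁) (c₂ ⊕ k₁) F[X]) (V : Matrix (c₁ ⊕ k₂) (c₁ ⊕ k₂) F[X]),
      IsUnimodular U ∧ IsUnimodular V ∧ U * blockMatrix M K₁ K₂ * V =
        Matrix.reindex e f (Matrix.fromBlocks 1 0 0 (N₂ * M * N₁.transpose)) := by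
  classical
  obtain ⟨R₁, S₁, hR₁, hS₁, hSR₁, -⟩ := exists_unimodular_completion hcard₁ hKN₁ hK₁ (hN₁ _)
  obtain ⟨R₂, S₂, hR₂, hS₂, hSR₂, -⟩ := exists_unimodular_completion hcard₂ hKN₂ hK₂ (hN₂ _)
  have hR₂' : R₂.transpose * K₂.transpose = 1 := by
    rw [← Matrix.transpose_mul, hR₂, Matrix.transpose_one]
  have hKN₂' : N₂ * K₂.transpose = 0 := by
    have := congrArg Matrix.transpose hKN₂
    rwa [Matrix.transpose_mul, Matrix.transpose_transpose, Matrix.transpose_zero] at this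
  have hSR₂' : R₂.transpose * S₂ = 0 := by
    have := congrArg Matrix.transpose hSR₂
    rwa [Matrix.transpose_mul, Matrix.transpose_transpose, Matrix.transpose_zero] at this
  have hS₁' : S₁.transpose * N₁.transpose = 1 := by
    rw [← Matrix.transpose_mul, hS₁, Matrix.transpose_one]
  set A := R₂.transpose * M * R₁ with hA
  set B := R₂.transpose * M * N₁.transpose with hB
  set C := N₂ * M * R₁ with hC
  -- `W` is a right inverse of `U'`, and `Z` is a left inverse of `V'`.
  let U' : Matrix ((k₂ ⊕ k₁) ⊕ m) (c₂ ⊕ k₁) F[X] :=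
    Matrix.fromRows (Matrix.fromBlocks R₂.transpose (-A) 0 1) (Matrix.fromCols N₂ (-C))
  let W : Matrix (c₂ ⊕ k₁) ((k₂ ⊕ k₁) ⊕ m) F[X] :=
    Matrix.fromCols (Matrix.fromBlocks K₂.transpose (K₂.transpose * A + S₂ * C) 0 1)
      (Matrix.fromRows S₂ 0)
  let V' : Matrix (c₁ ⊕ k₂) ((k₂ ⊕ k₁) ⊕ n) F[X] :=
    Matrix.fromCols (Matrix.fromBlocks 0 R₁ 1 0) (Matrix.fromRows N₁.transpose (-B))
  let Z : Matrix ((k₂ ⊕ k₁) ⊕ n) (c₁ ⊕ k₂) F[X] :=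
    Matrix.fromRows (Matrix.fromBlocks (B * S₁.transpose) 1 K₁ 0) (Matrix.fromCols S₁.transpose 0)
  have hUW : U' * W = 1 := by
    simp only [U', W, Matrix.fromRows_mul_fromCols, Matrix.fromBlocks_multiply,
      Matrix.fromBlocks_mul_fromRows, Matrix.fromCols_mul_fromBlocks, Matrix.fromCols_mul_fromRows,
      Matrix.mul_add, ← Matrix.mul_assoc, hR₂', hKN₂', hSR₂', hS₂]
    simp
  have hZV : Z * V' = 1 := by
    simp only [Z, V', Matrix.fromRows_mul_fromCols, Matrix.fromBlocks_multiply,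
      Matrix.fromBlocks_mul_fromRows, Matrix.fromCols_mul_fromBlocks, Matrix.fromCols_mul_fromRows,
      Matrix.mul_assoc, hS₁', hSR₁, hR₁, hKN₁]
    simp
  have hUL : U' * blockMatrix M K₁ K₂ =
      Matrix.fromRows (Matrix.fromBlocks (R₂.transpose * M - A * K₁) 1 K₁ 0)
        (Matrix.fromCols (N₂ * M - C * K₁) 0) := by
    simp [U', blockMatrix, Matrix.fromRows_mul, Matrix.fromBlocks_multiply,
      Matrix.fromCols_mul_fromBlocks, hR₂', hKN₂', sub_eq_add_neg]
  have hULV : U' * blockMatrix M K₁ K₂ * V' =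
      Matrix.fromBlocks 1 0 0 (N₂ * M * N₁.transpose) := by
    simp only [hUL, V', Matrix.fromRows_mul_fromCols, Matrix.fromBlocks_multiply,
      Matrix.fromBlocks_mul_fromRows, Matrix.fromCols_mul_fromBlocks, Matrix.fromCols_mul_fromRows,
      Matrix.sub_mul, Matrix.mul_assoc, hR₁, hKN₁]
    simp [hA, hB, hC, Matrix.mul_assoc]
  -- `U'` and `V'` have as many rows as columns, but their index types differ; reindexing makes
  -- them square.
  let e' : (k₂ ⊕ k₁) ⊕ m ≃ c₂ ⊕ k₁ := Fintype.equivOfCardEq (by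
    simp only [Fintype.card_sum]
    omega)
  let f' : (k₂ ⊕ k₁) ⊕ n ≃ c₁ ⊕ k₂ := Fintype.equivOfCardEq (by
    simp only [Fintype.card_sum]
    omega)
  let σ : Fin (Fintype.card (k₂ ⊕ k₁)) ≃ k₂ ⊕ k₁ := (Fintype.equivFin _).symm
  refine ⟨_, (σ.sumCongr (Equiv.refl m)).trans e', (σ.sumCongr (Equiv.refl n)).trans f',
    U'.submatrix e'.symm id, V'.submatrix id f'.symm,
    isUnimodular_of_mul_eq_one (W := W.submatrix id e'.symm) ?_, ?_, ?_⟩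
  · rw [← Matrix.submatrix_mul _ _ _ _ _ Function.bijective_id, hUW, Matrix.submatrix_one_equiv]
  · have h : Z.submatrix f'.symm id * V'.submatrix id f'.symm = 1 := by
      rw [← Matrix.submatrix_mul _ _ _ _ _ Function.bijective_id, hZV, Matrix.submatrix_one_equiv]
    exact isUnimodular_of_mul_eq_one (mul_eq_one_comm.1 h)
  · have h : U'.submatrix e'.symm id * blockMatrix M K₁ K₂ * V'.submatrix id f'.symm =
        (U' * blockMatrix M K₁ K₂ * V').submatrix e'.symm f'.symm := by
      rfl
    have hblocks : (Matrix.fromBlocks 1 0 0 (N₂ * M * N₁.transpose) :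
          Matrix ((k₂ ⊕ k₁) ⊕ m) ((k₂ ⊕ k₁) ⊕ n) F[X]) =
        (Matrix.fromBlocks 1 0 0 (N₂ * M * N₁.transpose)).submatrix
          (σ.sumCongr (Equiv.refl m)).symm (σ.sumCongr (Equiv.refl n)).symm := by
      refine Matrix.ext fun i j => ?_
      rcases i with i | i <;> rcases j with j | j <;> simp [Matrix.one_apply]
    rw [h, hULV, hblocks]
    rfl

end Reduction

/-! ### The degree of the block matrix -/

section Degree

variable {F : Type*} [Field F] {k₁ k₂ c₁ c₂ : Type*}

theorem IsBlockMinimalBases.hasGrade_left [Fintype k₁] [Fintype k₂] [Fintype c₁] [Fintype c₂]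
    {ℓ : ℕ} {M : Matrix c₂ c₁ F[X]} {K₁ : Matrix k₁ c₁ F[X]}
    {K₂ : Matrix k₂ c₂ F[X]} (h : IsBlockMinimalBases ℓ M K₁ K₂) : HasGrade ℓ K₁ := fun i j =>
  h.degree₁ ⟨i⟩ ▸ hasGrade_degree K₁ i j

theorem IsBlockMinimalBases.hasGrade_right [Fintype k₁] [Fintype k₂] [Fintype c₁] [Fintype c₂]
    {ℓ : ℕ} {M : Matrix c₂ c₁ F[X]}
    {K₁ : Matrix k₁ c₁ F[X]} {K₂ : Matrix k₂ c₂ F[X]} (h : IsBlockMinimalBases ℓ M K₁ K₂) :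
    HasGrade ℓ K₂ := fun i j =>
  h.degree₂ ⟨i⟩ ▸ hasGrade_degree K₂ i j

theorem hasGrade_blockMatrix {ℓ : ℕ} {M : Matrix c₂ c₁ F[X]} {K₁ : Matrix k₁ c₁ F[X]}
    {K₂ : Matrix k₂ c₂ F[X]} (hM : HasGrade ℓ M) (h₁ : HasGrade ℓ K₁) (h₂ : HasGrade ℓ K₂) :
    HasGrade ℓ (blockMatrix M K₁ K₂) := by
  rintro (i | i) (j | j)
  · exact hM i j
  · exact h₂ j i
  · exact h₁ i j
  · simp [blockMatrix]

theorem degree_le_degree_blockMatrix_left [Fintype k₁] [Fintype k₂] [Fintype c₁] [Fintype c₂]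
    (M : Matrix c₂ c₁ F[X]) (K₁ : Matrix k₁ c₁ F[X])
    (K₂ : Matrix k₂ c₂ F[X]) : degree K₁ ≤ degree (blockMatrix M K₁ K₂) :=
  degree_le_iff.2 fun i j => hasGrade_degree (blockMatrix M K₁ K₂) (Sum.inr i) (Sum.inl j)

theorem degree_le_degree_blockMatrix_right [Fintype k₁] [Fintype k₂] [Fintype c₁] [Fintype c₂]
    (M : Matrix c₂ c₁ F[X]) (K₁ : Matrix k₁ c₁ F[X])
    (K₂ : Matrix k₂ c₂ F[X]) : degree K₂ ≤ degree (blockMatrix M K₁ K₂) :=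
  degree_le_iff.2 fun i j => hasGrade_degree (blockMatrix M K₁ K₂) (Sum.inl j) (Sum.inr i)

theorem degree_blockMatrix [Fintype k₁] [Fintype k₂] [Fintype c₁] [Fintype c₂]
    {ℓ : ℕ} {M : Matrix c₂ c₁ F[X]} {K₁ : Matrix k₁ c₁ F[X]}
    {K₂ : Matrix k₂ c₂ F[X]} (hM : HasGrade ℓ M) (h₁ : HasGrade ℓ K₁) (h₂ : HasGrade ℓ K₂)
    (h : ℓ ≤ degree K₁ ∨ ℓ ≤ degree K₂) : degree (blockMatrix M K₁ K₂) = ℓ := by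
  refine le_antisymm (degree_le_iff.2 (hasGrade_blockMatrix hM h₁ h₂)) ?_
  rcases h with h | h
  · exact h.trans (degree_le_degree_blockMatrix_left M K₁ K₂)
  · exact h.trans (degree_le_degree_blockMatrix_right M K₁ K₂)

theorem rev_blockMatrix (ℓ : ℕ) (M : Matrix c₂ c₁ F[X]) (K₁ : Matrix k₁ c₁ F[X])
    (K₂ : Matrix k₂ c₂ F[X]) :
    rev ℓ (blockMatrix M K₁ K₂) = blockMatrix (rev ℓ M) (rev ℓ K₁) (rev ℓ K₂) := by
  refine Matrix.ext fun i j => ?_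
  rcases i with i | i <;> rcases j with j | j <;> simp [blockMatrix, rev]

/-- A matrix with a polynomial right inverse does not vanish at `0`, so that its reversals attain
the largest possible degree. -/
theorem le_degree_rev [Fintype k₁] [Fintype c₁] [DecidableEq k₁] [Nonempty k₁] (ℓ : ℕ)
    {K : Matrix k₁ c₁ F[X]}
    (hK : ∃ R : Matrix c₁ k₁ F[X], K * R = 1) : ℓ ≤ degree (rev ℓ K) := by
  obtain ⟨R, hR⟩ := hK
  obtain ⟨i⟩ := ‹Nonempty k₁›
  obtain ⟨j, hj⟩ : ∃ j, (K i j).coeff 0 ≠ 0 := by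
    by_contra! hcon
    have h := congrArg (fun p => p.coeff 0) (congrFun (congrFun hR i) i)
    simp [Matrix.mul_apply, finsetSum_coeff, mul_coeff_zero, hcon] at h
  refine le_trans (le_natDegree_of_ne_zero ?_) (hasGrade_degree (rev ℓ K) i j)
  simpa [rev] using hj

end Degree

end MatPoly

open MatPoly in
theorem mainTheorem1 {F : Type*} [Field F] {k₁ k₂ c₁ c₂ m n : Type*}
    [Fintype k₁] [Fintype k₂] [Fintype c₁] [Fintype c₂] [Fintype m] [Fintype n]
    [DecidableEq k₁] [DecidableEq k₂] [DecidableEq c₁] [DecidableEq c₂]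
    (ℓ : ℕ) (hℓ : 0 < ℓ)
    (M : Matrix c₂ c₁ F[X])
    (K₁ : Matrix k₁ c₁ F[X]) (N₁ : Matrix n c₁ F[X])
    (K₂ : Matrix k₂ c₂ F[X]) (N₂ : Matrix m c₂ F[X])
    (h₁ : MatPoly.IsDualMinimalBases K₁ N₁) (h₂ : MatPoly.IsDualMinimalBases K₂ N₂)
    (hL : MatPoly.IsBlockMinimalBases ℓ M K₁ K₂) :
    MatPoly.IsEllification ℓ (MatPoly.blockMatrix M K₁ K₂) (N₂ * M * N₁.transpose) ∧
    (MatPoly.IsStrongBlockMinimalBases ℓ M K₁ K₂ →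
      MatPoly.IsStrongEllification ℓ (MatPoly.blockMatrix M K₁ K₂)
        (ℓ + MatPoly.degree N₁ + MatPoly.degree N₂) (N₂ * M * N₁.transpose)) := by
  have ha : IsEllification ℓ (blockMatrix M K₁ K₂) (N₂ * M * N₁.transpose) := by
    refine ⟨hℓ, degree_blockMatrix hL.grade hL.hasGrade_left hL.hasGrade_right ?_, ?_⟩
    · exact hL.nonempty.imp (fun h => (hL.degree₁ h).ge) fun h => (hL.degree₂ h).ge
    · exact exists_unimodular_reduction M h₁.card_eq h₂.card_eq h₁.mul_transpose h₂.mul_transpose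
        h₁.left.exists_rightInverse h₂.left.exists_rightInverse
        (fun _ => h₁.right.exists_rightInverse) fun _ => h₂.right.exists_rightInverse
  refine ⟨ha, fun hS => ?_⟩
  -- By duality the rows of each `Nᵢ` have equal degrees, so that all of `K₁`, `K₂`, `N₁`, `N₂`
  -- remain minimal bases under reversal; the reversed problem is then an instance of the
  -- same reduction.
  have hgr₁ := (hasGrade_degree N₁).transpose
  have hgr₂ := hasGrade_degree N₂
  have hdeg : ℓ + degree N₁ + degree N₂ = degree N₂ + ℓ + degree N₁ := by omega
  rw [hdeg]
  refine ⟨(hgr₂.mul hL.grade).mul hgr₁, ha, ?_⟩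
  have hrev : rev (degree N₂ + ℓ + degree N₁) (N₂ * M * N₁.transpose) =
      rev (degree N₂) N₂ * rev ℓ M * (rev (degree N₁) N₁).transpose := by
    rw [rev_mul (hgr₂.mul hL.grade) hgr₁, rev_mul hgr₂ hL.grade]
    rfl
  have hKN₁ : rev ℓ K₁ * (rev (degree N₁) N₁).transpose = 0 := by
    have := rev_mul hL.hasGrade_left hgr₁
    rw [h₁.mul_transpose] at this
    exact this.symm.trans (Matrix.ext fun _ _ => reflect_zero)
  have hKN₂ : rev ℓ K₂ * (rev (degree N₂) N₂).transpose = 0 := by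
    have := rev_mul hL.hasGrade_right hgr₂.transpose
    rw [h₂.mul_transpose] at this
    exact this.symm.trans (Matrix.ext fun _ _ => reflect_zero)
  have hK₁ := (h₁.left.rev hS.rowDegree₁).exists_rightInverse
  have hK₂ := (h₂.left.rev hS.rowDegree₂).exists_rightInverse
  rw [hrev, rev_blockMatrix]
  refine ⟨hℓ, degree_blockMatrix hL.grade.rev hL.hasGrade_left.rev hL.hasGrade_right.rev ?_, ?_⟩
  · exact hL.nonempty.imp (fun (_ : Nonempty k₁) => le_degree_rev ℓ h₁.left.exists_rightInverse)
      fun (_ : Nonempty k₂) => le_degree_rev ℓ h₂.left.exists_rightInverse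
  · exact exists_unimodular_reduction (rev ℓ M) h₁.card_eq h₂.card_eq hKN₁ hKN₂ hK₁ hK₂
      (fun _ => (h₁.right.rev (h₁.rowDegree_eq_degree hS.dual₁)).exists_rightInverse)
      fun _ => (h₂.right.rev (h₂.rowDegree_eq_degree hS.dual₂)).exists_rightInverse
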